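/- Let $A=\mathbb Z[\sigma_1,\sigma_2,\dots]$ be the polynomial ring over $\mathbb Z$ in countably many independent variables. A family $\mathcal S_1,\dots,\mathcal S_n$ of non-empty subsets of a group $G$ with identity $e$ is called generic if $g_{i_1}g_{i_2}\cdots g_{i_k}\neq e$ for every sequence $i_1,\dots,i_k$ of $k\ge 1$ distinct elements of $\{1,\dots,n\}$ and all $g_{i_j}\in\mathcal S_{i_j}^{-1}\mathcal S_{i_j}\setminus\{e\}$. A packing of $\mathcal S_1,\dots,\mathcal S_n$ is an element $(g_1,\dots,g_n)\in G^n$ such that the left translates $g_1\mathcal S_1,\dots,g_n\mathcal S_n$ are pairwise disjoint. Let $U=U(x,\sigma_1,\sigma_2,\dots)\in A[[x]]$ be a formal power series which counts packings of generic families in the following sense: for every $n\ge 1$, every finite group $G$ with $N$ elements and every generic family $\mathcal S_1,\dots,\mathcal S_n$ of $n$ non-empty subsets of $G$, the series $N^nU(N^{-1},\sigma_1,\sigma_2,\dots)$, in which the variables $\sigma_1,\sigma_2,\dots$ are replaced by the integers defined by $\sum_{j\ge 0}\sigma_jt^j=\prod_{k=1}^n(1+\sharp(\mathcal S_k)\,t)$,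 converges absolutely and its sum is the number of packings of $\mathcal S_1,\dots,\mathcal S_n$. **Proposition.** Every such series $U$ satisfies, in $A[[x]]$, the functional equation $$(1-\sigma_1x)\,U(x,\sigma_1,\sigma_2,\sigma_3,\dots)=U(x,\tilde\sigma_1,\tilde\sigma_2,\tilde\sigma_3,\dots),$$ where $\tilde\sigma_i=\sigma_{i-1}+\sigma_i$ for $i\ge 1$, with the convention $\sigma_0=1$. -/

import Mathlib

open scoped Pointwise

/-- The ring `A = ℤ[σ₁, σ₂, σ₃, …]`; the variable `σ i` is `MvPolynomial.X i`, for `i ≥ 1`. -/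
abbrev SigmaRing : Type := MvPolynomial ℕ+ ℤ

/-- The element `σ i` of `A` for every natural number `i`, with the convention `σ 0 = 1`. -/
noncomputable def sigma (i : ℕ) : SigmaRing :=
  if h : 0 < i then MvPolynomial.X ⟨i, h⟩ else 1

/-- The polynomial `σ̃ i = σ (i - 1) + σ i` of `A`, for `i ≥ 1`. -/
noncomputable def sigmaTilde (i : ℕ+) : SigmaRing :=
  sigma ((i : ℕ) - 1) + sigma (i : ℕ)

/-- The series `U(x, σ̃₁, σ̃₂, …)` in `A[[x]]`: the ring endomorphism `σ i ↦ σ̃ i` of `A` is applied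
to every coefficient of `U(x, σ₁, σ₂, …)`. -/
noncomputable def substTilde (U : PowerSeries SigmaRing) : PowerSeries SigmaRing :=
  PowerSeries.map (MvPolynomial.aeval sigmaTilde : SigmaRing →ₐ[ℤ] SigmaRing).toRingHom U

/-- Genericity of a family of subsets of a group: no product `g i₁ * ⋯ * g iₖ` with
`k ≥ 1` distinct indices `i₁, …, iₖ`, in any order, and with `g i ∈ (S i)⁻¹ * S i`, `g i ≠ 1`
for each of these indices, is equal to `1`. -/
def IsGenericFamily {G : Type*} [Group G] {n : ℕ} (S : Fin n → Set G) : Prop :=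
  ∀ l : List (Fin n), l ≠ [] → l.Nodup →
    ∀ g : Fin n → G, (∀ i ∈ l, g i ∈ ((S i)⁻¹ * S i) \ {1}) → (l.map g).prod ≠ 1

/-- The packings of `S 1, …, S n`: the `(g 1, …, g n) ∈ G ^ n` such that the left translates
`g i • S i` are pairwise disjoint. -/
def packings {G : Type*} [Group G] {n : ℕ} (S : Fin n → Set G) : Set (Fin n → G) :=
  {g | Pairwise fun i j => Disjoint (g i • S i) (g j • S j)}

/-- The integers `σ j` attached to a finite family of natural numbers `s k`, given by
`∑ j, σ j * t ^ j = ∏ k, (1 + s k * t)`. -/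
noncomputable def sigmaValue {n : ℕ} (s : Fin n → ℕ) (j : ℕ) : ℤ :=
  (∏ k, (1 + Polynomial.C (s k : ℤ) * Polynomial.X)).coeff j

/-- `U ∈ A[[x]]` counts packings of generic families: for every generic family `S 1, …, S n` of
`n ≥ 1` non-empty subsets of a finite group `G` with `N` elements, the series
`N ^ n * U(1 / N, σ₁, σ₂, …)`, with the `σ j` evaluated on the cardinalities of the `S k`,
converges (as a series of real numbers), and its sum is the number of packings. -/
def IsPackingCountingSeries (U : PowerSeries SigmaRing) : Prop :=
  ∀ (G : Type) [Group G] [Finite G] (n : ℕ) (S : Fin n → Set G),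
    1 ≤ n → (∀ i, (S i).Nonempty) → IsGenericFamily S →
    HasSum
      (fun m : ℕ => (Nat.card G : ℝ) ^ n *
        ((MvPolynomial.eval (fun j : ℕ+ => sigmaValue (fun k => (S k).ncard) j)
          (PowerSeries.coeff m U) : ℤ) * ((Nat.card G : ℝ)⁻¹) ^ m))
      ((packings S).ncard : ℝ)

/-!
If `S₁, …, Sₙ` is a generic family in a group of order `N`, then `U(1 / N)`, evaluated at the sizes
of the `Sᵢ`, is the probability that uniformly random left translates of the `Sᵢ` are pairwise
disjoint. Adjoining the singleton `{1}` keeps the family generic, replaces `σᵢ` by `σ̃ᵢ`, and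
multiplies this probability by `1 - σ₁ / N`, because `N - σ₁` of the `N` translates of `{1}` avoid
a given packing. Hence both sides of the functional equation have the same sum at `x = 1 / N`.

Writing integers in base `M` yields generic families of any prescribed sizes in every sufficiently
large cyclic group, so the two sides, specialised to these sizes, agree at points accumulating at
`0`. Their coefficients are therefore equal, first at all families of positive sizes and then, by
the algebraic independence of the elementary symmetric polynomials, in `A`.
-/

open Filter Topology

section PowerSeriesSums

open PowerSeries

/-- Convergence of the formal power series `P` at the point `x`, with sum `y`. The sum is
unconditional, which over `ℝ` means absolute convergence. -/
def HasSumAt {R : Type*} [Semiring R] [TopologicalSpace R] (P : PowerSeries R) (x y : R) : Prop :=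
  HasSum (fun m => coeff m P * x ^ m) y

namespace HasSumAt

variable {R : Type*} [TopologicalSpace R] {x y z : R}

theorem sub [Ring R] [IsTopologicalAddGroup R] {P Q : PowerSeries R} (hP : HasSumAt P x y)
    (hQ : HasSumAt Q x z) : HasSumAt (P - Q) x (y - z) := by
  simpa only [HasSumAt, map_sub, sub_mul] using HasSum.sub hP hQ

theorem C_mul [Semiring R] [IsTopologicalSemiring R] {P : PowerSeries R} (h : HasSumAt P x y)
    (c : R) : HasSumAt (C c * P) x (c * y) := by
  simpa only [HasSumAt, coeff_C_mul, mul_assoc] using HasSum.mul_left c h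

theorem X_mul [CommRing R] [IsTopologicalRing R] {P : PowerSeries R} (h : HasSumAt P x y) :
    HasSumAt (X * P) x (x * y) := by
  rw [HasSumAt, ← hasSum_nat_add_iff' 1]
  simpa [coeff_succ_X_mul, pow_succ', mul_left_comm] using HasSum.mul_left x h

theorem one_sub_C_mul_X_mul [CommRing R] [IsTopologicalRing R] {P : PowerSeries R}
    (h : HasSumAt P x y) (c : R) : HasSumAt ((1 - C c * X) * P) x ((1 - c * x) * y) := by
  simpa only [sub_mul, one_mul, mul_assoc] using h.sub (h.X_mul.C_mul c)

variable {𝕜 : Type*} [NontriviallyNormedField 𝕜]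

theorem ofScalars_radius_pos {P : PowerSeries 𝕜} {x y : 𝕜} (hx : x ≠ 0) (h : HasSumAt P x y) :
    0 < (FormalMultilinearSeries.ofScalars 𝕜 fun m => coeff m P).radius := by
  have hterms : Tendsto (fun m => ‖coeff m P‖ * ‖x‖ ^ m) atTop (𝓝 0) := by
    simpa only [norm_mul, norm_pow, norm_zero] using h.summable.tendsto_atTop_zero.norm
  refine lt_of_lt_of_le ?_ (FormalMultilinearSeries.le_radius_of_tendsto (r := ‖x‖₊) _ (l := 0) ?_)
  · simpa using hx
  · simpa only [FormalMultilinearSeries.ofScalars_norm, coe_nnnorm] using hterms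

theorem sum_ofScalars {P : PowerSeries 𝕜} {x y : 𝕜} (h : HasSumAt P x y) :
    (FormalMultilinearSeries.ofScalars 𝕜 fun m => coeff m P).sum x = y :=
  (FormalMultilinearSeries.ofScalars_sum_eq _ x).trans h.tsum_eq

end HasSumAt

theorem eq_of_frequently_hasSumAt {𝕜 : Type*} [NontriviallyNormedField 𝕜] [CompleteSpace 𝕜]
    {P Q : PowerSeries 𝕜} (h : ∃ᶠ x in 𝓝[≠] 0, ∃ y, HasSumAt P x y ∧ HasSumAt Q x y) : P = Q := by
  obtain ⟨x, ⟨y, hPx, hQx⟩, hx⟩ := (h.and_eventually self_mem_nhdsWithin).exists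
  have hP := (FormalMultilinearSeries.hasFPowerSeriesOnBall _
    (hPx.ofScalars_radius_pos hx)).hasFPowerSeriesAt
  have hQ := (FormalMultilinearSeries.hasFPowerSeriesOnBall _
    (hQx.ofScalars_radius_pos hx)).hasFPowerSeriesAt
  have hsum := (hP.analyticAt.frequently_eq_iff_eventually_eq hQ.analyticAt).1 <|
    h.mono fun z ⟨w, hPz, hQz⟩ => hPz.sum_ofScalars.trans hQz.sum_ofScalars.symm
  have hcoeff := FormalMultilinearSeries.ofScalars_series_injective 𝕜 𝕜
    (hP.eq_formalMultilinearSeries_of_eventually hQ hsum)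
  exact PowerSeries.ext (congrFun hcoeff)

end PowerSeriesSums

section SymmetricPolynomials

open MvPolynomial

theorem coeff_prod_one_add_C_mul_X {ι R : Type*} [Fintype ι] [CommSemiring R] (a : ι → R) (j : ℕ) :
    (∏ k, (1 + Polynomial.C (a k) * Polynomial.X)).coeff j = eval a (esymm ι R j) := by
  classical
  have hmonomial (t : Finset ι) : ∏ k ∈ t, (Polynomial.C (a k) * Polynomial.X) =
      Polynomial.C (∏ k ∈ t, a k) * Polynomial.X ^ t.card := by
    rw [Finset.prod_mul_distrib, map_prod, Finset.prod_const]
  calc (∏ k, (1 + Polynomial.C (a k) * Polynomial.X)).coeff j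
      = ∑ t : Finset ι, if j = t.card then ∏ k ∈ t, a k else 0 := by
        simp only [Finset.prod_one_add, Polynomial.finsetSum_coeff, hmonomial,
          Polynomial.coeff_C_mul, Polynomial.coeff_X_pow, mul_ite, mul_one, mul_zero,
          Finset.powerset_univ]
    _ = eval a (esymm ι R j) := by
        simp only [esymm, Finset.powersetCard_eq_filter, Finset.powerset_univ, Finset.sum_filter,
          map_sum, apply_ite (eval a), map_prod, eval_X, map_zero, eq_comm]

theorem eq_zero_of_eval_esymm_eq_zero {R : Type*} [CommRing R] [IsDomain R] {A : Set R}
    (hA : A.Infinite) {n : ℕ} {q : MvPolynomial (Fin n) R}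
    (h : ∀ x : Fin n → R, (∀ k, x k ∈ A) →
      eval (fun i : Fin n => eval x (esymm (Fin n) R (i + 1))) q = 0) : q = 0 := by
  apply esymmAlgHom_fin_injective R le_rfl
  rw [map_zero]
  apply Subtype.ext
  refine funext_set (fun _ => A) (fun _ => hA) fun x hx => ?_
  rw [esymmAlgHom_apply, ← coe_aeval_eq_eval, RingHom.coe_coe, comp_aeval_apply]
  simpa using h x fun k => hx k trivial

theorem exists_rename_succPNat_eq {R : Type*} [CommSemiring R] (F : MvPolynomial ℕ+ R) :
    ∃ (n : ℕ) (q : MvPolynomial (Fin (n + 1)) R),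
      rename (fun i : Fin (n + 1) => Nat.succPNat i) q = F := by
  refine ⟨F.vars.sup PNat.val, exists_rename_eq_of_vars_subset_range F _
    (Nat.succPNat_injective.comp Fin.val_injective) fun i hi => ?_⟩
  have hlt : i.natPred < F.vars.sup PNat.val + 1 :=
    (Nat.sub_le _ _).trans_lt (Nat.lt_succ_of_le (Finset.le_sup (f := PNat.val) hi))
  exact ⟨⟨i.natPred, hlt⟩, i.succPNat_natPred⟩

end SymmetricPolynomials

section Sizes

variable {n : ℕ} (s : Fin n → ℕ)

theorem sigmaValue_eq_eval_esymm (j : ℕ) :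
    sigmaValue s j =
      MvPolynomial.eval (fun k => (s k : ℤ)) (MvPolynomial.esymm (Fin n) ℤ j) :=
  coeff_prod_one_add_C_mul_X _ j

theorem sigmaValue_zero : sigmaValue s 0 = 1 := by
  simp [sigmaValue_eq_eval_esymm]

theorem sigmaValue_one : sigmaValue s 1 = ∑ k, (s k : ℤ) := by
  simp [sigmaValue_eq_eval_esymm, MvPolynomial.esymm_one]

theorem sigmaValue_cons_one (j : ℕ) :
    sigmaValue (Fin.cons 1 s : Fin (n + 1) → ℕ) (j + 1) =
      sigmaValue s j + sigmaValue s (j + 1) := by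
  simp only [sigmaValue, Fin.prod_univ_succ, Fin.cons_zero, Fin.cons_succ, add_mul, one_mul,
    Polynomial.coeff_add, Nat.cast_one, map_one, Polynomial.coeff_X_mul]
  exact add_comm _ _

/-- The evaluation `A → ℤ` sending `σ j` to the `j`-th elementary symmetric function of the
numbers `s k`. -/
noncomputable def evalSizes : SigmaRing →+* ℤ :=
  MvPolynomial.eval fun j : ℕ+ => sigmaValue s j

theorem evalSizes_sigma (j : ℕ) : evalSizes s (sigma j) = sigmaValue s j := by
  rcases Nat.eq_zero_or_pos j with rfl | hj
  · simp [sigma, sigmaValue_zero]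
  · rw [sigma, dif_pos hj]
    exact MvPolynomial.eval_X (⟨j, hj⟩ : ℕ+)

theorem evalSizes_sigmaTilde (i : ℕ+) :
    evalSizes s (sigmaTilde i) = sigmaValue (Fin.cons 1 s : Fin (n + 1) → ℕ) i := by
  have hi : (i : ℕ) = (i - 1 : ℕ) + 1 := (Nat.succ_pred_eq_of_pos i.pos).symm
  rw [sigmaTilde, map_add, evalSizes_sigma, evalSizes_sigma, hi, sigmaValue_cons_one,
    Nat.add_sub_cancel]

theorem evalSizes_aeval_sigmaTilde (F : SigmaRing) :
    evalSizes s (MvPolynomial.aeval sigmaTilde F) =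
      evalSizes (Fin.cons 1 s : Fin (n + 1) → ℕ) F := by
  have h := MvPolynomial.comp_aeval_apply (f := sigmaTilde) (evalSizes s).toIntAlgHom F
  simp only [evalSizes_sigmaTilde, RingHom.toIntAlgHom_apply] at h
  exact h

theorem eq_zero_of_evalSizes_eq_zero {F : SigmaRing}
    (h : ∀ (n : ℕ) (s : Fin n → ℕ), 1 ≤ n → (∀ k, 1 ≤ s k) → evalSizes s F = 0) : F = 0 := by
  obtain ⟨n, q, rfl⟩ := exists_rename_succPNat_eq F
  have hpos : ((↑) '' Set.Ici 1 : Set ℤ).Infinite :=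
    (Set.Ici_infinite (1 : ℕ)).image Nat.cast_injective.injOn
  suffices q = 0 by rw [this, map_zero]
  refine eq_zero_of_eval_esymm_eq_zero hpos fun x hx => ?_
  choose s hs hsx using hx
  obtain rfl : (fun k => (s k : ℤ)) = x := funext hsx
  have heval := h (n + 1) s n.succ_pos hs
  rw [evalSizes, MvPolynomial.eval_rename] at heval
  simpa only [Function.comp_def, sigmaValue_eq_eval_esymm, Nat.succPNat_coe] using heval

/-- The real power series obtained from `U ∈ A[[x]]` by giving each `σ j` its value at the sizes
`s k`. -/
noncomputable def atSizes : PowerSeries SigmaRing →+* PowerSeries ℝ :=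
  PowerSeries.map ((Int.castRingHom ℝ).comp (evalSizes s))

theorem coeff_atSizes (U : PowerSeries SigmaRing) (m : ℕ) :
    PowerSeries.coeff m (atSizes s U) = (evalSizes s (PowerSeries.coeff m U) : ℝ) :=
  PowerSeries.coeff_map _ _ _

theorem atSizes_one_sub_sigma_one_mul_X_mul (U : PowerSeries SigmaRing) :
    atSizes s ((1 - PowerSeries.C (sigma 1) * PowerSeries.X) * U) =
      (1 - PowerSeries.C (∑ k, (s k : ℝ)) * PowerSeries.X) * atSizes s U := by
  simp [atSizes, evalSizes_sigma, sigmaValue_one]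

theorem atSizes_substTilde (U : PowerSeries SigmaRing) :
    atSizes s (substTilde U) = atSizes (Fin.cons 1 s : Fin (n + 1) → ℕ) U := by
  ext m
  rw [coeff_atSizes, coeff_atSizes, ← evalSizes_aeval_sigmaTilde, substTilde,
    PowerSeries.coeff_map]
  rfl

theorem eq_of_atSizes_eq {U V : PowerSeries SigmaRing}
    (h : ∀ (n : ℕ) (s : Fin n → ℕ), 1 ≤ n → (∀ k, 1 ≤ s k) → atSizes s U = atSizes s V) :
    U = V := by
  ext1 m
  refine sub_eq_zero.1 (eq_zero_of_evalSizes_eq_zero fun n s hn hs => ?_)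
  have hm := congrArg (PowerSeries.coeff m) (h n s hn hs)
  rw [coeff_atSizes, coeff_atSizes, Int.cast_inj] at hm
  rw [map_sub, hm, sub_self]

end Sizes

section Packings

variable {G : Type*} [Group G] {n : ℕ} {S : Fin n → Set G}

theorem IsGenericFamily.cons {T : Set G} (hT : T.Subsingleton) (hS : IsGenericFamily S) :
    IsGenericFamily (Fin.cons T S : Fin (n + 1) → Set G) := by
  intro l hl hnodup g hg
  have hzero : ∀ i ∈ l, i ≠ 0 := by
    rintro i hi rfl
    obtain ⟨⟨a, ha, b, hb, hab⟩, hne⟩ := hg 0 hi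
    exact hne (by rw [← hab, ← hT ha hb]; simp)
  obtain ⟨l, rfl⟩ : ∃ l' : List (Fin n), l'.map Fin.succ = l :=
    ⟨l.pmap (fun i hi => i.pred hi) hzero, by simp [List.map_pmap]⟩
  rw [List.map_map]
  exact hS l (by simpa using hl) (List.Nodup.of_map _ hnodup) _ fun i hi =>
    hg i.succ (List.mem_map_of_mem hi)

theorem cons_mem_packings_cons_iff {T : Set G} {a : G} {g : Fin n → G} :
    (Fin.cons a g : Fin (n + 1) → G) ∈ packings (Fin.cons T S : Fin (n + 1) → Set G) ↔
      g ∈ packings S ∧ Disjoint (a • T) (⋃ i, g i • S i) := by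
  simp only [packings, Set.mem_ofPred_eq, Pairwise, Fin.forall_fin_succ, Fin.cons_zero,
    Fin.cons_succ, Set.disjoint_iUnion_right, ne_eq, Fin.succ_inj, not_true, Fin.succ_ne_zero,
    (Fin.succ_ne_zero _).symm, not_false_eq_true, forall_const, IsEmpty.forall_iff, true_and,
    disjoint_comm (b := a • T), forall_and]
  tauto

theorem cons_mem_packings_cons_one_iff {a : G} {g : Fin n → G} :
    (Fin.cons a g : Fin (n + 1) → G) ∈ packings (Fin.cons {1} S : Fin (n + 1) → Set G) ↔
      g ∈ packings S ∧ a ∈ (⋃ i, g i • S i)ᶜ := by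
  rw [cons_mem_packings_cons_iff, Set.smul_set_singleton, smul_eq_mul, mul_one,
    Set.disjoint_singleton_left, Set.mem_compl_iff]

theorem ncard_iUnion_smul_of_mem_packings [Finite G] {g : Fin n → G} (hg : g ∈ packings S) :
    (⋃ i, g i • S i).ncard = ∑ i, (S i).ncard := by
  rw [Set.ncard_iUnion_of_finite (fun i => Set.toFinite _) hg, finsum_eq_sum_of_fintype]
  simp only [Set.ncard_smul_set]

/-- A packing of `{1}, S 1, …, S n` is a packing of `S 1, …, S n` together with a point outside
its translates. -/
def packingsConsOneEquiv (S : Fin n → Set G) :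
    packings (Fin.cons {1} S : Fin (n + 1) → Set G) ≃
      Σ g : packings S, ((⋃ i, g.1 i • S i)ᶜ : Set G) where
  toFun g :=
    have hg := cons_mem_packings_cons_one_iff.1 ((Fin.cons_self_tail g.1).symm ▸ g.2)
    ⟨⟨Fin.tail g.1, hg.1⟩, ⟨g.1 0, hg.2⟩⟩
  invFun p := ⟨Fin.cons p.2.1 p.1.1, cons_mem_packings_cons_one_iff.2 ⟨p.1.2, p.2.2⟩⟩
  left_inv g := Subtype.ext (Fin.cons_self_tail g.1)
  right_inv _ := rfl

theorem ncard_packings_cons_one [Finite G] (S : Fin n → Set G) :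
    ((packings (Fin.cons {1} S : Fin (n + 1) → Set G)).ncard : ℝ) =
      (Nat.card G - ∑ i, ((S i).ncard : ℝ)) * (packings S).ncard := by
  have := Fintype.ofFinite (packings S)
  have hcompl (g : packings S) : (Nat.card ((⋃ i, g.1 i • S i)ᶜ : Set G) : ℝ) =
      Nat.card G - ∑ i, ((S i).ncard : ℝ) := by
    rw [Nat.card_coe_set_eq, eq_sub_iff_add_eq', ← Nat.cast_sum,
      ← ncard_iUnion_smul_of_mem_packings g.2]
    exact_mod_cast Set.ncard_add_ncard_compl _
  rw [← Nat.card_coe_set_eq, Nat.card_congr (packingsConsOneEquiv S), Nat.card_sigma,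
    Nat.cast_sum, Finset.sum_congr rfl fun g _ => hcompl g, Finset.sum_const, Finset.card_univ,
    nsmul_eq_mul, mul_comm, ← Nat.card_eq_fintype_card, Nat.card_coe_set_eq]

/-- The probability that uniformly random left translates of the sets `S i` are pairwise
disjoint. -/
noncomputable def packingDensity (S : Fin n → Set G) : ℝ :=
  (packings S).ncard / (Nat.card G : ℝ) ^ n

theorem packingDensity_cons_one [Finite G] (S : Fin n → Set G) :
    packingDensity (Fin.cons {1} S : Fin (n + 1) → Set G) =
      (1 - (∑ i, ((S i).ncard : ℝ)) * (Nat.card G : ℝ)⁻¹) * packingDensity S := by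
  have hG : (Nat.card G : ℝ) ≠ 0 := Nat.cast_ne_zero.2 Nat.card_pos.ne'
  rw [packingDensity, packingDensity, ncard_packings_cons_one]
  field_simp
  ring

/-- `U ∈ A[[x]]` counts the packings of the single family `S`: the series `N ^ n * U(1 / N)`, with
`N` the order of the group and the `σ j` evaluated at the cardinalities of the `S k`, converges to
the number of packings of `S`. -/
def CountsPackings (U : PowerSeries SigmaRing) (S : Fin n → Set G) : Prop :=
  HasSum
    (fun m : ℕ => (Nat.card G : ℝ) ^ n *
      ((MvPolynomial.eval (fun j : ℕ+ => sigmaValue (fun k => (S k).ncard) j)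
        (PowerSeries.coeff m U) : ℤ) * ((Nat.card G : ℝ)⁻¹) ^ m))
    ((packings S).ncard : ℝ)

namespace CountsPackings

variable [Finite G] {U : PowerSeries SigmaRing}

theorem hasSumAt (h : CountsPackings U S) :
    HasSumAt (atSizes (fun k => (S k).ncard) U) (Nat.card G : ℝ)⁻¹ (packingDensity S) := by
  have hG : (Nat.card G : ℝ) ^ n ≠ 0 := pow_ne_zero _ (Nat.cast_ne_zero.2 Nat.card_pos.ne')
  rw [packingDensity, div_eq_inv_mul]
  simpa only [HasSumAt, inv_mul_cancel_left₀ hG, coeff_atSizes, evalSizes] using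
    HasSum.mul_left ((Nat.card G : ℝ) ^ n)⁻¹ h

theorem hasSumAt_one_sub_sigma_one_mul_X_mul (h : CountsPackings U S) :
    HasSumAt (atSizes (fun k => (S k).ncard)
        ((1 - PowerSeries.C (sigma 1) * PowerSeries.X) * U))
      (Nat.card G : ℝ)⁻¹ (packingDensity (Fin.cons {1} S : Fin (n + 1) → Set G)) := by
  rw [atSizes_one_sub_sigma_one_mul_X_mul, packingDensity_cons_one]
  exact h.hasSumAt.one_sub_C_mul_X_mul _

theorem hasSumAt_substTilde (h : CountsPackings U (Fin.cons {1} S : Fin (n + 1) → Set G)) :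
    HasSumAt (atSizes (fun k => (S k).ncard) (substTilde U)) (Nat.card G : ℝ)⁻¹
      (packingDensity (Fin.cons {1} S : Fin (n + 1) → Set G)) := by
  have hsizes : (fun k => ((Fin.cons {1} S : Fin (n + 1) → Set G) k).ncard) =
      Fin.cons 1 fun k => (S k).ncard :=
    funext (Fin.forall_fin_succ.2 ⟨by simp, fun _ => rfl⟩)
  rw [atSizes_substTilde, ← hsizes]
  exact h.hasSumAt

end CountsPackings

end Packings

section Digits

variable {n : ℕ} {M : ℤ}

theorem abs_sum_mul_pow_lt {d : Fin n → ℤ} (hd : ∀ i, |d i| < M) :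
    |∑ i, d i * M ^ (i : ℕ)| < M ^ n := by
  induction n with
  | zero => simp
  | succ n ih =>
    have hM : 0 < M := (abs_nonneg _).trans_lt (hd 0)
    have htail := ih fun i => hd i.castSucc
    rw [Fin.sum_univ_castSucc]
    simp only [Fin.val_castSucc, Fin.val_last]
    calc |∑ i : Fin n, d i.castSucc * M ^ (i : ℕ) + d (Fin.last n) * M ^ n|
        ≤ |∑ i : Fin n, d i.castSucc * M ^ (i : ℕ)| + |d (Fin.last n)| * M ^ n := by
          simpa only [abs_mul, abs_of_pos (pow_pos hM n)] using abs_add_le _ (_ * M ^ n)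
      _ < M ^ n + (M - 1) * M ^ n :=
          add_lt_add_of_lt_of_le htail
            (mul_le_mul_of_nonneg_right (Int.le_sub_one_of_lt (hd _)) (by positivity))
      _ = M ^ (n + 1) := by ring

theorem eq_zero_of_sum_mul_pow_eq_zero {d : Fin n → ℤ} (hd : ∀ i, |d i| < M)
    (h : ∑ i, d i * M ^ (i : ℕ) = 0) : d = 0 := by
  induction n with
  | zero => exact Subsingleton.elim _ _
  | succ n ih =>
    have hM : 0 < M := (abs_nonneg _).trans_lt (hd 0)
    have hsplit : d 0 + M * ∑ i : Fin n, d i.succ * M ^ (i : ℕ) = 0 := by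
      rw [← h, Fin.sum_univ_succ, Finset.mul_sum]
      simp [pow_succ', mul_left_comm]
    have hzero : d 0 = 0 := Int.eq_zero_of_abs_lt_dvd
      ((dvd_add_left (dvd_mul_right _ _)).1 (hsplit ▸ dvd_zero M)) (hd 0)
    rw [hzero, zero_add] at hsplit
    have htail := ih (fun i => hd i.succ) ((mul_eq_zero_iff_left hM.ne').1 hsplit)
    exact funext (Fin.forall_fin_succ.2 ⟨hzero, congrFun htail⟩)

theorem eq_zero_of_dvd_sum_mul_pow {N : ℤ} (hN : M ^ n ≤ N) {d : Fin n → ℤ}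
    (hd : ∀ i, |d i| < M) (h : N ∣ ∑ i, d i * M ^ (i : ℕ)) : d = 0 :=
  eq_zero_of_sum_mul_pow_eq_zero hd <|
    Int.eq_zero_of_abs_lt_dvd h ((abs_sum_mul_pow_lt hd).trans_le hN)

end Digits

section DigitFamily

variable {n M N : ℕ} {s : Fin n → ℕ}

/-- The family of subsets of the cyclic group `ℤ / N`, written multiplicatively, whose `i`-th
member consists of the `a * M ^ i` with `a < s i`, i.e. of numbers with a single nonzero digit in
base `M`. -/
def digitFamily (M N : ℕ) (s : Fin n → ℕ) (i : Fin n) : Set (Multiplicative (ZMod N)) :=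
  (fun a : ℕ => Multiplicative.ofAdd ((a * M ^ (i : ℕ) : ℕ) : ZMod N)) '' Set.Iio (s i)

theorem ncard_digitFamily (hN : M ^ n ≤ N) {i : Fin n} (hs : s i ≤ M) :
    (digitFamily M N s i).ncard = s i := by
  have hM : ∀ a < s i, 0 < M := fun a ha => ha.pos.trans_le hs
  have hlt : ∀ a < s i, a * M ^ (i : ℕ) < N := fun a ha =>
    calc a * M ^ (i : ℕ) < M * M ^ (i : ℕ) :=
          Nat.mul_lt_mul_of_pos_right (ha.trans_le hs) (pow_pos (hM a ha) _)
      _ = M ^ (i + 1 : ℕ) := (pow_succ' _ _).symm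
      _ ≤ M ^ n := Nat.pow_le_pow_right (hM a ha) i.isLt
      _ ≤ N := hN
  rw [digitFamily, Set.InjOn.ncard_image, ← Finset.coe_Iio, Set.ncard_coe_finset, Nat.card_Iio]
  intro a ha b hb hab
  have hmod := (ZMod.natCast_eq_natCast_iff' _ _ _).1 (Multiplicative.ofAdd.injective hab)
  rw [Nat.mod_eq_of_lt (hlt a ha), Nat.mod_eq_of_lt (hlt b hb)] at hmod
  exact Nat.eq_of_mul_eq_mul_right (pow_pos (hM a ha) _) hmod

theorem exists_digit_of_mem_inv_mul_digitFamily {i : Fin n} (hs : s i ≤ M)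
    {g : Multiplicative (ZMod N)} (hg : g ∈ (digitFamily M N s i)⁻¹ * digitFamily M N s i) :
    ∃ d : ℤ, |d| < M ∧ g = Multiplicative.ofAdd ((d * (M : ℤ) ^ (i : ℕ) : ℤ) : ZMod N) := by
  obtain ⟨u, ⟨a, ha, hau⟩, v, ⟨b, hb, rfl⟩, rfl⟩ := hg
  have haM : a < M := ha.out.trans_le hs
  have hbM : b < M := hb.out.trans_le hs
  refine ⟨b - a, by rw [abs_lt]; omega, ?_⟩
  rw [← inv_inv u, ← hau]
  simp only [← ofAdd_neg, ← ofAdd_add]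
  congr 1
  push_cast
  ring

theorem isGenericFamily_digitFamily (hN : M ^ n ≤ N) (hs : ∀ i, s i ≤ M) :
    IsGenericFamily (digitFamily M N s) := by
  intro l hl hnodup g hg hprod
  obtain ⟨k, hk⟩ := List.exists_mem_of_ne_nil l hl
  have hM : (0 : ℤ) < M :=
    let ⟨_, hd, _⟩ := exists_digit_of_mem_inv_mul_digitFamily (hs k) (hg k hk).1
    (abs_nonneg _).trans_lt hd
  have hdigit (i : Fin n) : ∃ d : ℤ, |d| < M ∧ (i ∉ l → d = 0) ∧
      (i ∈ l → g i = Multiplicative.ofAdd ((d * (M : ℤ) ^ (i : ℕ) : ℤ) : ZMod N)) := by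
    by_cases hi : i ∈ l
    · obtain ⟨d, hd, hgd⟩ := exists_digit_of_mem_inv_mul_digitFamily (hs i) (hg i hi).1
      exact ⟨d, hd, absurd hi, fun _ => hgd⟩
    · exact ⟨0, by rwa [abs_zero], fun _ => rfl, fun h => absurd h hi⟩
  choose d hd hd_zero hgd using hdigit
  have hdvd : (N : ℤ) ∣ ∑ i, d i * (M : ℤ) ^ (i : ℕ) := by
    rw [← List.prod_toFinset g hnodup,
      Finset.prod_congr rfl fun i hi => hgd i (List.mem_toFinset.1 hi), ← ofAdd_sum,
      ← Int.cast_sum, ofAdd_eq_one, ZMod.intCast_zmod_eq_zero_iff_dvd] at hprod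
    rwa [← Finset.sum_subset (Finset.subset_univ l.toFinset)]
    intro i _ hi
    rw [hd_zero i (by simpa using hi), zero_mul]
  have hd_eq : d = 0 := eq_zero_of_dvd_sum_mul_pow (by exact_mod_cast hN) hd hdvd
  exact (hg k hk).2 (by simp [hgd k hk, hd_eq])

theorem eventually_exists_isGenericFamily_zmod (s : Fin n → ℕ) :
    ∀ᶠ N : ℕ in atTop, ∃ S : Fin n → Set (Multiplicative (ZMod N)),
      IsGenericFamily S ∧ (fun i => (S i).ncard) = s := by
  have hs (i : Fin n) : s i ≤ ∑ k, s k :=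
    Finset.single_le_sum_of_canonicallyOrdered (Finset.mem_univ i)
  filter_upwards [eventually_ge_atTop ((∑ k, s k) ^ n)] with N hN
  exact ⟨digitFamily (∑ k, s k) N s, isGenericFamily_digitFamily hN hs,
    funext fun i => ncard_digitFamily hN (hs i)⟩

end DigitFamily

theorem proposition2p3_general (U : PowerSeries SigmaRing)
    (hU : ∃ᶠ N : ℕ in atTop, ∀ (n : ℕ) (S : Fin n → Set (Multiplicative (ZMod N))),
      1 ≤ n → (∀ i, (S i).Nonempty) → IsGenericFamily S → CountsPackings U S) :
    (1 - PowerSeries.C (sigma 1) * PowerSeries.X) * U = substTilde U := by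
  refine eq_of_atSizes_eq fun n s hn hs => eq_of_frequently_hasSumAt ?_
  have hinv : Tendsto (fun N : ℕ => (N : ℝ)⁻¹) atTop (𝓝[≠] 0) :=
    (tendsto_inv_atTop_nhdsGT_zero.comp tendsto_natCast_atTop_atTop).mono_right
      (nhdsGT_le_nhdsNE 0)
  refine hinv.frequently ((hU.and_eventually
    ((eventually_exists_isGenericFamily_zmod s).and (eventually_gt_atTop 0))).mono ?_)
  rintro N ⟨hcount, ⟨S, hS, rfl⟩, hN⟩
  have : NeZero N := ⟨hN.ne'⟩
  have hne (i : Fin n) : (S i).Nonempty :=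
    Set.nonempty_of_ncard_ne_zero (Nat.one_le_iff_ne_zero.1 (hs i))
  have hS_count := hcount n S hn hne hS
  have hcons_count := hcount (n + 1) (Fin.cons {1} S) n.succ_pos
    (Fin.forall_fin_succ.2 ⟨Set.singleton_nonempty 1, hne⟩) (hS.cons Set.subsingleton_singleton)
  have hcard : Nat.card (Multiplicative (ZMod N)) = N := Nat.card_zmod N
  have hleft := hS_count.hasSumAt_one_sub_sigma_one_mul_X_mul
  have hright := hcons_count.hasSumAt_substTilde
  rw [hcard] at hleft hright
  exact ⟨_, hleft, hright⟩

theorem proposition2p3 (U : PowerSeries SigmaRing) (hU : IsPackingCountingSeries U) :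
    (1 - PowerSeries.C (sigma 1) * PowerSeries.X) * U = substTilde U :=
  proposition2p3_general U <| ((eventually_gt_atTop 0).mono fun N hN n S =>
    have : NeZero N := ⟨hN.ne'⟩
    hU (Multiplicative (ZMod N)) n S).frequently
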